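/- Let $C$ be a commutative ring with identity and $X$ a set. Let $\mathbf{Bax}^0_C$ be the category of pairs $(R,P)$, where $R$ is an associative commutative $C$-algebra, not necessarily with identity, and $P:R\to R$ is a $C$-linear Baxter operator of weight $-1$, i.e. $P(x)P(y)=P(xP(y))+P(yP(x))-P(xy)$ for all $x,y\in R$; a morphism is a $C$-linear multiplicative map that commutes with the operators. A sub-Baxter algebra of $(R,P)$ is a $C$-submodule of $R$ closed under the multiplication and under $P$. Let $M$ be the free commutative semigroup with identity on $X$, so that $M$ is the monomial basis of the polynomial algebra $C[X]$. **The algebra $\mathfrak B(X)$.** Let $\mathfrak B(X)$ be the free $C$-module on the symbols $u_0\cdot[u_1,\ldots,u_m]$ with $m\ge 0$, $u_0,\ldots,u_m\in M$ and $u_m\ne 1$ (for $m=0$ the symbol is $u_0\cdot[\ ]$ with $u_0\neq 1$). Its $C$-bilinear multiplication $\diamond_c$ is given by $$(u_0\cdot[\ ])\diamond_c(v_0\cdot[v_1,\ldots,v_n])=(v_0\cdot[v_1,\ldots,v_n])\diamond_c(u_0\cdot[\ ])=u_0v_0\cdot[v_1,\ldots,v_n]\quad(n\ge 0)$$ and,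 for $m,n\ge 1$, $$(u_0\cdot[u_1,\ldots,u_m])\diamond_c(v_0\cdot[v_1,\ldots,v_n])=\sum_{(k,P,Q)}(-1)^{k+m+n}\,u_0v_0\cdot[c_1,\ldots,c_k],$$ where the sum is over all $1\le k\le m+n$ and $P,Q\subseteq\{1,\ldots,k\}$ with $P\cup Q=\{1,\ldots,k\}$, $|P|=m$, $|Q|=n$, and where $c_j=u_\alpha$ if $j$ is the $\alpha$-th element of $P$ and $j\notin Q$, $c_j=v_\beta$ if $j$ is the $\beta$-th element of $Q$ and $j\notin P$, and $c_j=u_\alpha v_\beta$ if both $j$ is the $\alpha$-th element of $P$ and the $\beta$-th element of $Q$. Its operator is the $C$-linear map $P^c_X$ with $P_X^c(u_0\cdot[u_1,\ldots,u_m])=1\cdot[u_0,u_1,\ldots,u_m]$. **The algebra $\mathrm{Sh}_C(X)$.** Put $A=C[X]$ and $\mathrm{Sh}_C(X)=A\otimes_C\bigoplus_{k\ge 0}A^{\otimes k}=\bigoplus_{k\geq 0}A^{\otimes(k+1)}$, with the $C$-bilinear product $$(x_0\otimes\cdots\otimes x_m)\diamond(y_0\otimes\cdots\otimes y_n)=x_0y_0\otimes\sum_{(\sigma,T)}(-1)^{|T|}\,z_{\sigma(1)}\,\hat\otimes\,z_{\sigma(2)}\,\hat\otimes\cdots\hat\otimes\,z_{\sigma(m+n)},\qquad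 (z_1,\ldots,z_{m+n})=(x_1,\ldots,x_m,y_1,\ldots,y_n).$$ Here $\sigma$ runs over the permutations of $\{1,\ldots,m+n\}$ for which $\sigma^{-1}$ is increasing on $\{1,\ldots,m\}$ and on $\{m+1,\ldots,m+n\}$, $T$ runs over the sets of pairs $(k,k+1)$ with $1\le k<m+n$ and $\sigma(k)\le m<\sigma(k+1)$, and the $k$-th symbol $\hat\otimes$ (the one between $z_{\sigma(k)}$ and $z_{\sigma(k+1)}$) is the product of $A$ if $(k,k+1)\in T$ and is $\otimes$ otherwise. The operator is the $C$-linear map $P_X$ with $P_X(x_0\otimes\cdots\otimes x_m)=1\otimes x_0\otimes\cdots\otimes x_m$. **Proposition.** $(\mathfrak B(X),P_X^c)$ and $(\mathrm{Sh}_C(X),P_X)$ are objects of $\mathbf{Bax}^0_C$, and the $C$-linear map $f:\mathfrak B(X)\to \mathrm{Sh}_C(X)$ with $f(u_0\cdot[u_1,\ldots,u_m])=u_0\otimes u_1\otimes\cdots\otimes u_m$ is an injective morphism in $\mathbf{Bax}^0_C$. Its image is a sub-Baxter algebra of $\mathrm{Sh}_C(X)$, and the tensors $u_0\otimes\cdots\otimes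 u_m$ with $m\ge 0$, $u_0,\ldots,u_m\in M$, $u_m\neq 1$ form a $C$-basis of the image. -/

import Mathlib

open scoped TensorProduct DirectSum

/-! ### Baxter algebras that need not have an identity -/

/-- `(R, mul, P)` is an object of the category of (commutative) Baxter `C`-algebras of weight `lam`
not necessarily having an identity: the `C`-bilinear multiplication `mul` on the `C`-module `R` is
associative and commutative, and the `C`-linear operator `P` satisfies
`P(x) P(y) = P(x P(y)) + P(y P(x)) + lam P(x y)`. -/
structure IsBaxterAlgebra {C R : Type*} [CommRing C] [AddCommGroup R] [Module C R]
    (lam : C) (mul : R →ₗ[C] R →ₗ[C] R) (P : R →ₗ[C] R) : Prop where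
  mul_assoc : ∀ x y z : R, mul (mul x y) z = mul x (mul y z)
  mul_comm : ∀ x y : R, mul x y = mul y x
  baxter : ∀ x y : R, mul (P x) (P y) = P (mul x (P y)) + P (mul y (P x)) + lam • P (mul x y)

/-- The linear map `f` is a morphism of Baxter algebras (no identity is involved): it is
multiplicative and commutes with the operators. -/
structure IsBaxterHom {C R S : Type*} [CommRing C] [AddCommGroup R] [Module C R]
    [AddCommGroup S] [Module C S] (mulR : R →ₗ[C] R →ₗ[C] R) (PR : R →ₗ[C] R)
    (mulS : S →ₗ[C] S →ₗ[C] S) (PS : S →ₗ[C] S) (f : R →ₗ[C] S) : Prop where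
  map_mul : ∀ x y : R, f (mulR x y) = mulS (f x) (f y)
  map_op : ∀ x : R, f (PR x) = PS (f x)

/-- The submodule `N` is a sub-Baxter algebra (no identity is involved): it is closed under the
multiplication and under the operator. -/
structure IsSubBaxterAlgebra {C R : Type*} [CommRing C] [AddCommGroup R] [Module C R]
    (mul : R →ₗ[C] R →ₗ[C] R) (P : R →ₗ[C] R) (N : Submodule C R) : Prop where
  mul_mem : ∀ x ∈ N, ∀ y ∈ N, mul x y ∈ N
  op_mem : ∀ x ∈ N, P x ∈ N

/-! ### Mixable shuffles of permutations -/

/-- The set `S(m,n)` of `(m,n)`-shuffles: permutations `σ` of `m + n` letters such that `σ⁻¹` is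
increasing on the first `m` letters and on the last `n` letters. -/
def shuffles (m n : ℕ) : Set (Equiv.Perm (Fin (m + n))) :=
  {σ | StrictMono (fun i : Fin m => σ.symm (Fin.castAdd n i)) ∧
    StrictMono (fun j : Fin n => σ.symm (Fin.natAdd m j))}

/-- The set of admissible pairs `(k, k+1)` of `σ`: the position `k` carries one of the first `m`
letters and the position `k + 1` carries one of the last `n` letters. A pair is recorded by its
first member. -/
def admissible (m n : ℕ) (σ : Equiv.Perm (Fin (m + n))) : Set (Fin (m + n - 1)) :=
  {k | (σ ⟨k, by omega⟩ : ℕ) < m ∧ m ≤ (σ ⟨k + 1, by omega⟩ : ℕ)}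

/-- The set of mixable `(m,n)`-shuffles `(σ, T)`. -/
abbrev MixableShuffle (m n : ℕ) : Type :=
  {p : Equiv.Perm (Fin (m + n)) × Finset (Fin (m + n - 1)) //
    p.1 ∈ shuffles m n ∧ (p.2 : Set (Fin (m + n - 1))) ⊆ admissible m n p.1}

noncomputable instance (m n : ℕ) : Fintype (MixableShuffle m n) := Fintype.ofFinite _

/-! ### The mixable shuffle product -/

/-- Given a set `T` of places `(k, k+1)` at which a sequence of length `N` is to be merged, the
position, after the merging, of the entry in position `i`: the number of places before `i` that
are not merged. -/
def blockIndex {N : ℕ} (T : Finset (Fin (N - 1))) (i : Fin N) : Fin (N - T.card) :=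
  ⟨(Finset.univ.filter fun k : Fin (N - 1) => k ∉ T ∧ (k : ℕ) < i).card, by
    have h1 : (Finset.univ.filter fun k : Fin (N - 1) => k ∉ T ∧ (k : ℕ) < i).card ≤ Tᶜ.card :=
      Finset.card_le_card fun k hk => by
        simp only [Finset.mem_filter] at hk
        simpa using hk.2.1
    have h2 := Finset.card_le_univ T
    rw [Finset.card_compl] at h1
    simp only [Fintype.card_fin] at h1 h2
    have := i.isLt
    omega⟩

section Shuffle

variable (C : Type*) [CommRing C] (A : Type*) [CommRing A] [Algebra C A]

/-- The underlying module `⨁ₖ A^{⊗k}` of the mixable shuffle algebra. -/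
abbrev ShPlus : Type _ := ⨁ k : ℕ, ⨂[C]^k A

/-- The pure tensor `x₁ ⊗ ⋯ ⊗ xₙ` in `⨁ₖ A^{⊗k}`. -/
noncomputable def pureTensor {n : ℕ} (x : Fin n → A) : ShPlus C A :=
  DirectSum.lof C ℕ (fun k => ⨂[C]^k A) n (PiTensorProduct.tprod C x)

/-- The merged tensor `z₁ ⊗̂ z₂ ⊗̂ ⋯ ⊗̂ z_N`, where the symbol `⊗̂` at the place `(k, k+1)` is the
product of `A` if `(k, k+1) ∈ T` and is `⊗` otherwise, as a multilinear map of `z`. -/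
noncomputable def mergeTensor {N : ℕ} (T : Finset (Fin (N - 1))) :
    MultilinearMap C (fun _ : Fin N => A) (⨂[C]^(N - T.card) A) :=
  ((PiTensorProduct.tprod C).compMultilinearMap fun j : Fin (N - T.card) =>
      MultilinearMap.mkPiAlgebra C {i : Fin N // blockIndex T i = j} A).domDomCongr
    (Equiv.sigmaFiberEquiv (blockIndex T))

theorem mergeTensor_apply {N : ℕ} (T : Finset (Fin (N - 1))) (z : Fin N → A) :
    mergeTensor C A T z = PiTensorProduct.tprod C
      (fun j : Fin (N - T.card) => ∏ i : {i : Fin N // blockIndex T i = j}, z i) := rfl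

/-- The linear map `x ⊗ y ↦ σ(x ⊗ y; T)` from `A^{⊗(m+n)}` to `⨁ₖ A^{⊗k}`. -/
noncomputable def mixShuffle {N : ℕ} (σ : Equiv.Perm (Fin N)) (T : Finset (Fin (N - 1))) :
    (⨂[C]^N A) →ₗ[C] ShPlus C A :=
  DirectSum.lof C ℕ (fun k => ⨂[C]^k A) (N - T.card) ∘ₗ
    PiTensorProduct.lift ((mergeTensor C A T).domDomCongr σ)

variable {C} in
/-- The mixable shuffle product of weight `lam` on `A^{⊗m} × A^{⊗n}`,
`(x, y) ↦ ∑_{(σ,T)} lam^{|T|} σ(x ⊗ y; T)`. If `m = 0` or `n = 0`, the only mixable shuffle is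
`(id, ∅)` and the product is the multiplication by scalars. -/
noncomputable def shPlusMulComponent (lam : C) (m n : ℕ) :
    (⨂[C]^m A) →ₗ[C] (⨂[C]^n A) →ₗ[C] ShPlus C A :=
  (TensorProduct.mk C (⨂[C]^m A) (⨂[C]^n A)).compr₂
    ((∑ p : MixableShuffle m n, lam ^ p.1.2.card • mixShuffle C A p.1.1 p.1.2) ∘ₗ
      (TensorPower.mulEquiv (R := C) (M := A) (n := m) (m := n)).toLinearMap)

variable {C} in
/-- The mixable shuffle product of weight `lam` on `⨁ₖ A^{⊗k}`. -/
noncomputable def shPlusMul (lam : C) : ShPlus C A →ₗ[C] ShPlus C A →ₗ[C] ShPlus C A :=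
  DirectSum.toModule C ℕ _ fun m =>
    (DirectSum.toModule C ℕ _ fun n => (shPlusMulComponent A lam m n).flip).flip

theorem shPlusMul_pureTensor (lam : C) {m n : ℕ} (x : Fin m → A) (y : Fin n → A) :
    shPlusMul A lam (pureTensor C A x) (pureTensor C A y) =
      ∑ p : MixableShuffle m n, lam ^ p.1.2.card • pureTensor C A
        (fun j : Fin (m + n - p.1.2.card) =>
          ∏ i : {i : Fin (m + n) // blockIndex p.1.2 i = j}, Fin.append x y (p.1.1 i)) := by
  have h : TensorPower.mulEquiv (PiTensorProduct.tprod C x ⊗ₜ[C] PiTensorProduct.tprod C y) =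
      PiTensorProduct.tprod C (Fin.append x y) := TensorPower.tprod_mul_tprod C x y
  simp [shPlusMul, shPlusMulComponent, pureTensor, h, mixShuffle, mergeTensor_apply]

/-- The underlying module `A ⊗ ⨁ₖ A^{⊗k}`, that is `⨁ₖ A^{⊗(k+1)}`, of the free Baxter algebra
`Ш_C(A)`. -/
abbrev Sh : Type _ := A ⊗[C] ShPlus C A

/-- The pure tensor `u₀ ⊗ u₁ ⊗ ⋯ ⊗ uₘ` in `Ш_C(A)`. -/
noncomputable def shTensor {m : ℕ} (u : Fin (m + 1) → A) : Sh C A :=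
  u 0 ⊗ₜ[C] pureTensor C A (Fin.tail u)

variable {C} in
/-- The augmented mixable shuffle product of weight `lam` on `Ш_C(A)`: the multiplication of the
tensor product of the algebra `A` with the mixable shuffle algebra. -/
noncomputable def shMul (lam : C) : Sh C A →ₗ[C] Sh C A →ₗ[C] Sh C A :=
  TensorProduct.map₂ (LinearMap.mul C A) (shPlusMul A lam)

/-- The map `x₀ ⊗ (x₁ ⊗ ⋯ ⊗ xₙ) ↦ x₀ ⊗ x₁ ⊗ ⋯ ⊗ xₙ` from `A ⊗ ⨁ₖ A^{⊗k}` to `⨁ₖ A^{⊗k}`. -/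
noncomputable def shPrepend : Sh C A →ₗ[C] ShPlus C A :=
  TensorProduct.lift <| LinearMap.flip <| DirectSum.toModule C ℕ _ fun n => LinearMap.flip <|
    (TensorProduct.mk C A (⨂[C]^n A)).compr₂
      (DirectSum.lof C ℕ (fun k => ⨂[C]^k A) (n + 1) ∘ₗ
        (TensorPower.cast C A (Nat.add_comm 1 n)).toLinearMap ∘ₗ
        (TensorPower.mulEquiv (R := C) (M := A) (n := 1) (m := n)).toLinearMap ∘ₗ
        TensorProduct.map (PiTensorProduct.subsingletonEquiv (R := C) (s := fun _ => A)
          (0 : Fin 1)).symm.toLinearMap LinearMap.id)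

/-- The Baxter operator `x₀ ⊗ ⋯ ⊗ xₙ ↦ 1 ⊗ x₀ ⊗ ⋯ ⊗ xₙ` of `Ш_C(A)`. -/
noncomputable def shOp : Sh C A →ₗ[C] Sh C A :=
  TensorProduct.mk C A (ShPlus C A) 1 ∘ₗ shPrepend C A

theorem shOp_shTensor {m : ℕ} (u : Fin (m + 1) → A) :
    shOp C A (shTensor C A u) = shTensor C A (Fin.cons 1 u : Fin (m + 1 + 1) → A) := by
  have h (x : Fin 1 → A) (y : Fin m → A) :
      TensorPower.mulEquiv (PiTensorProduct.tprod C x ⊗ₜ[C] PiTensorProduct.tprod C y) =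
      PiTensorProduct.tprod C (Fin.append x y) := TensorPower.tprod_mul_tprod C x y
  simp [shOp, shPrepend, shTensor, pureTensor, h, PiTensorProduct.subsingletonEquiv_symm_apply',
    TensorPower.cast_tprod]
  rw [Fin.append_left_eq_cons]
  congr 3
  funext i
  simp [Fin.cons_self_tail]

end Shuffle

/-! ### Cartier's construction -/

/-- The free commutative semigroup with identity on `X`, written multiplicatively. -/
abbrev FreeCommMon (X : Type*) : Type _ := Multiplicative (X →₀ ℕ)

theorem FreeCommMon.eq_one_of_mul {X : Type*} {a b : FreeCommMon X} (h : a * b = 1) :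
    a = 1 ∧ b = 1 := by
  have h' : a.toAdd + b.toAdd = 0 := h
  exact add_eq_zero.1 h'

/-- The symbols `u₀ · [u₁, …, uₘ]`, `m ≥ 0`, with entries in the free commutative semigroup with
identity on `X`, whose last entry (`u₀` if `m = 0`, and `uₘ` otherwise) is not `1`. -/
structure CartierSymbol (X : Type*) where
  /-- the length `m` of the bracket -/
  len : ℕ
  /-- the entries `u₀, u₁, …, uₘ` -/
  entry : Fin (len + 1) → FreeCommMon X
  last_ne_one : entry (Fin.last len) ≠ 1

namespace CartierSymbol

variable {X : Type*}

/-- The symbol `a v₀ · [v₁, …, vₙ]`. -/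
noncomputable def scale (a : FreeCommMon X) (v : CartierSymbol X) : CartierSymbol X where
  len := v.len
  entry := Fin.cons (a * v.entry 0) (Fin.tail v.entry)
  last_ne_one := by
    obtain ⟨n, e, h⟩ := v
    cases n with
    | zero => exact fun h' => h (FreeCommMon.eq_one_of_mul h').2
    | succ n => exact h

/-- The symbol `1 · [u₀, u₁, …, uₘ]`. -/
def shift (u : CartierSymbol X) : CartierSymbol X where
  len := u.len + 1
  entry := Fin.cons 1 u.entry
  last_ne_one := by
    exact u.last_ne_one

theorem entry_zero_ne_one (u : CartierSymbol X) (hu : u.len = 0) : u.entry 0 ≠ 1 := by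
  have h : (0 : Fin (u.len + 1)) = Fin.last u.len := Fin.ext (by simp [hu])
  rw [h]
  exact u.last_ne_one

theorem tail_orderIso_ne_one (u : CartierSymbol X) {k : ℕ} {P : Finset (Fin (k + 1))}
    (hP : P.card = u.len) (h : Fin.last k ∈ P) :
    Fin.tail u.entry ((P.orderIsoOfFin hP).symm ⟨Fin.last k, h⟩) ≠ 1 := by
  have hj : ((P.orderIsoOfFin hP).symm ⟨Fin.last k, h⟩).succ = Fin.last u.len := by
    set j := (P.orderIsoOfFin hP).symm ⟨Fin.last k, h⟩ with hjd
    have hle (i : Fin u.len) : i ≤ j := by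
      rw [hjd, OrderIso.le_symm_apply]
      exact Fin.le_last ((P.orderIsoOfFin hP i : Fin (k + 1)))
    have hpos : 0 < u.len := j.pos
    have := hle ⟨u.len - 1, by omega⟩
    rw [Fin.le_def] at this
    have := j.isLt
    ext
    simp only [Fin.val_succ, Fin.val_last]
    simp only at *
    omega
  unfold Fin.tail
  rw [hj]
  exact u.last_ne_one

end CartierSymbol

/-- The set of the pairs `(P, Q)` of subsets of a set of `k` elements with `P ∪ Q` everything,
`|P| = m` and `|Q| = n`. -/
abbrev CartierPair (m n k : ℕ) : Type :=
  {p : Finset (Fin k) × Finset (Fin k) // p.1 ∪ p.2 = Finset.univ ∧ p.1.card = m ∧ p.2.card = n}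

section Cartier

variable {X : Type*}

/-- The entry `c_j` of `Φ_{k,P,Q}([a₁, …, aₘ], [b₁, …, bₙ])`: it is `a_α` if `j` is the `α`-th
element of `P` and `j ∉ Q`, it is `b_β` if `j` is the `β`-th element of `Q` and `j ∉ P`, and it is
`a_α b_β` if both hold. -/
noncomputable def cartierPhi {m n k : ℕ} (p : CartierPair m n k) (a : Fin m → FreeCommMon X)
    (b : Fin n → FreeCommMon X) (j : Fin k) : FreeCommMon X :=
  (if h : j ∈ p.1.1 then a ((p.1.1.orderIsoOfFin p.2.2.1).symm ⟨j, h⟩) else 1) *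
    (if h : j ∈ p.1.2 then b ((p.1.2.orderIsoOfFin p.2.2.2).symm ⟨j, h⟩) else 1)

/-- The symbol `u₀ v₀ · Φ_{k,P,Q}([u₁, …, uₘ], [v₁, …, vₙ])`. -/
noncomputable def cartierMerge (u v : CartierSymbol X) {k : ℕ} (p : CartierPair u.len v.len k) :
    CartierSymbol X where
  len := k
  entry := Fin.cons (u.entry 0 * v.entry 0) (cartierPhi p (Fin.tail u.entry) (Fin.tail v.entry))
  last_ne_one := by
    intro hlast
    cases k with
    | zero =>
      have hm : u.len = 0 := by
        rw [← p.2.2.1, Finset.eq_empty_of_isEmpty p.1.1, Finset.card_empty]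
      exact u.entry_zero_ne_one hm (FreeCommMon.eq_one_of_mul hlast).1
    | succ k =>
      obtain ⟨h1, h2⟩ := FreeCommMon.eq_one_of_mul
        (show cartierPhi p (Fin.tail u.entry) (Fin.tail v.entry) (Fin.last k) = 1 from hlast)
      have hmem : Fin.last k ∈ p.1.1 ∪ p.1.2 := by rw [p.2.1]; exact Finset.mem_univ _
      rcases Finset.mem_union.1 hmem with h | h
      · rw [dif_pos h] at h1
        exact u.tail_orderIso_ne_one p.2.2.1 h h1
      · rw [dif_pos h] at h2
        exact v.tail_orderIso_ne_one p.2.2.2 h h2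

variable (C : Type*) [CommRing C] (X)

/-- Cartier's algebra `𝔅(X)` as a module: the free `C`-module on the symbols. -/
abbrev CartierAlgebra : Type _ := CartierSymbol X →₀ C

variable {X} in
/-- Cartier's product of two symbols. -/
noncomputable def cartierMulSymbol (u v : CartierSymbol X) : CartierAlgebra X C :=
  if u.len = 0 then Finsupp.single (v.scale (u.entry 0)) 1
  else if v.len = 0 then Finsupp.single (u.scale (v.entry 0)) 1
  else ∑ k ∈ Finset.Icc 1 (u.len + v.len), ∑ p : CartierPair u.len v.len k,
    Finsupp.single (cartierMerge u v p) ((-1) ^ (k + u.len + v.len))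

/-- Cartier's bilinear multiplication on `𝔅(X)`. -/
noncomputable def cartierMul :
    CartierAlgebra X C →ₗ[C] CartierAlgebra X C →ₗ[C] CartierAlgebra X C :=
  Finsupp.linearCombination C fun u =>
    Finsupp.linearCombination C fun v => cartierMulSymbol C u v

/-- Cartier's operator `u₀ · [u₁, …, uₘ] ↦ 1 · [u₀, u₁, …, uₘ]`. -/
noncomputable def cartierOp : CartierAlgebra X C →ₗ[C] CartierAlgebra X C :=
  Finsupp.linearCombination C fun u => Finsupp.single u.shift 1

/-! ### The comparison map -/

variable {X} in
/-- The tensor `u₀ ⊗ u₁ ⊗ ⋯ ⊗ uₘ` of monomials in `Ш_C(X) = Ш_C(C[X])`. -/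
noncomputable def monomialTensor {m : ℕ} (u : Fin (m + 1) → FreeCommMon X) :
    Sh C (MvPolynomial X C) :=
  shTensor C (MvPolynomial X C) fun i => MvPolynomial.monomial (u i).toAdd 1

/-- The linear map `f : 𝔅(X) → Ш_C(X)` with `u₀ · [u₁, …, uₘ] ↦ u₀ ⊗ u₁ ⊗ ⋯ ⊗ uₘ`. -/
noncomputable def cartierToSh : CartierAlgebra X C →ₗ[C] Sh C (MvPolynomial X C) :=
  Finsupp.linearCombination C fun u => monomialTensor C u.entry

end Cartier

/-!
The mixable shuffle product of two pure tensors is defined as a sum over pairs `(σ, T)` of a shuffle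
and a set of mergings, Cartier's product as a sum over pairs `(P, Q)` of sets that cover
`{1, …, k}`. Both describe the same thing: recording the positions that the letters of the two
words occupy after the merging turns `(σ, T)` into a covering pair, and this is a bijection
(`MixableShuffle.cover_injective`, `MixableShuffle.exists_cover_eq`). Hence the product of
`⨁ₖ A^{⊗k}` is a sum over covering pairs (`shPlusMul_eq_sum_coverSum`), with the sign of Cartier's
formula when the weight is `-1`, and the comparison map is multiplicative.

Sums over covering pairs are easy to handle. They are symmetric in the two words, and splitting them
according to whether the first position lies in `P` only, in `Q` only, or in both gives the recursion
`(a ⊗ v)(b ⊗ w) = a ⊗ v(b ⊗ w) + b ⊗ (a ⊗ v)w + lam ab ⊗ vw` of the quasi-shuffle product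
(`shPlusMul_prepend`). Associativity follows from it by induction on the three factors
(`shPlusMul_assoc`), and the Baxter identity in `Ш_C(A)` is the recursion itself.

Finally the tensors of monomials form a basis of `Ш_C(X)`, so the comparison map, which sends the
symbols to distinct members of that basis, is injective. The Baxter algebra laws of `𝔅(X)` are pulled
back along it, and the basis of symbols is carried over to the image.
-/

/-! ### Words spread over a set of positions -/

section Spread

variable {A : Type*}

/-- The word of length `k` that carries the letters `a 0, a 1, …`, in this order, in the positions
belonging to `P`, and `1` in all the other positions. -/
def spread [One A] {k : ℕ} (P : Finset (Fin k)) (a : ℕ → A) (j : Fin k) : A :=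
  if j ∈ P then a (P.filter (· < j)).card else 1

/-- The infinite word that begins with `x` and continues with `1`. Infinite words spare the statements
about `spread` the dependence of a finite word on its length. -/
def extendOne [One A] {m : ℕ} (x : Fin m → A) (i : ℕ) : A :=
  if h : i < m then x ⟨i, h⟩ else 1

theorem extendOne_cons_zero [One A] {m : ℕ} (c : A) (x : Fin m → A) :
    extendOne (Fin.cons c x : Fin (m + 1) → A) 0 = c := by
  simp [extendOne]

theorem extendOne_cons_succ [One A] {m : ℕ} (c : A) (x : Fin m → A) :
    (fun i => extendOne (Fin.cons c x : Fin (m + 1) → A) (i + 1)) = extendOne x := by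
  funext i
  by_cases h : i < m
  · simp only [extendOne, add_lt_add_iff_right, h, dif_pos]
    exact Fin.cons_succ (α := fun _ => A) c x ⟨i, h⟩
  · simp [extendOne, h]

theorem spread_map_succ [One A] {k : ℕ} (P : Finset (Fin k)) (a : ℕ → A) :
    spread (P.map (Fin.succEmb k)) a = Fin.cons 1 (spread P a) := by
  funext j
  refine Fin.cases ?_ (fun j => ?_) j
  · simp [spread]
  · simp [spread, Finset.filter_map, Function.comp_def]

theorem spread_insert_zero [One A] {k : ℕ} (P : Finset (Fin k)) (a : ℕ → A) :
    spread (insert 0 (P.map (Fin.succEmb k))) a =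
      Fin.cons (a 0) (spread P fun i => a (i + 1)) := by
  funext j
  refine Fin.cases ?_ (fun j => ?_) j
  · simp [spread]
  · have h : Finset.card (insert 0 ((P.filter (· < j)).map (Fin.succEmb k))) =
        (P.filter (· < j)).card + 1 := by
      rw [Finset.card_insert_of_notMem (by simp), Finset.card_map]
    simp [spread, Finset.filter_insert, Finset.filter_map, Function.comp_def, h]

theorem spread_univ [One A] {n : ℕ} (x : Fin n → A) :
    spread Finset.univ (extendOne x) = x := by
  funext j
  have h : Finset.univ.filter (· < j) = Finset.Iio j := by ext; simp
  simp [spread, extendOne, h]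

/-- A word placed along a strictly increasing sequence `f` of positions. -/
theorem prod_ite_eq_spread [CommMonoid A] {m k : ℕ} {f : Fin m → Fin k} (hf : StrictMono f)
    (x : Fin m → A) (j : Fin k) :
    (∏ i, if f i = j then x i else 1) = spread (Finset.univ.image f) (extendOne x) j := by
  by_cases hj : j ∈ Finset.univ.image f
  · obtain ⟨i, -, rfl⟩ := Finset.mem_image.1 hj
    have h1 : (Finset.univ.image f).filter (· < f i) = (Finset.Iio i).image f := by
      ext l
      simp only [Finset.mem_filter, Finset.mem_image, Finset.mem_univ, true_and, Finset.mem_Iio]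
      constructor
      · rintro ⟨⟨i', rfl⟩, h⟩
        exact ⟨i', hf.lt_iff_lt.1 h, rfl⟩
      · rintro ⟨i', h, rfl⟩
        exact ⟨⟨i', rfl⟩, hf h⟩
    rw [spread, if_pos hj, h1, Finset.card_image_of_injective _ hf.injective]
    simp [extendOne, hf.injective.eq_iff]
  · rw [spread, if_neg hj]
    refine Finset.prod_eq_one fun i _ => if_neg ?_
    rintro rfl
    exact hj (Finset.mem_image_of_mem _ (Finset.mem_univ _))

end Spread

/-! ### Sums over pairs of sets covering all positions -/

theorem sum_finset_fin_succ {M : Type*} [AddCommMonoid M] {k : ℕ}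
    (F : Finset (Fin (k + 1)) → M) :
    ∑ P, F P = ∑ P : Finset (Fin k),
      (F (P.map (Fin.succEmb k)) + F (insert 0 (P.map (Fin.succEmb k)))) := by
  have h0 : (0 : Fin (k + 1)) ∉ Finset.univ.image (Fin.succ : Fin k → Fin (k + 1)) := by simp
  have h1 : (Finset.univ : Finset (Finset (Fin (k + 1)))) =
      (insert 0 (Finset.univ.image (Fin.succ : Fin k → Fin (k + 1)))).powerset := by
    rw [← Finset.powerset_univ]
    congr 1
    ext j
    refine Fin.cases ?_ (fun j => ?_) j <;> simp
  have hinj : Function.Injective (Finset.image (Fin.succ : Fin k → Fin (k + 1))) :=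
    Finset.image_injective (Fin.succ_injective k)
  rw [h1, Finset.sum_powerset_insert h0, Finset.powerset_image, Finset.sum_image hinj.injOn,
    Finset.sum_image hinj.injOn, Finset.powerset_univ, ← Finset.sum_add_distrib]
  simp only [Finset.map_eq_image, Fin.coe_succEmb]

section Cover

variable {C : Type*} [CommRing C] {A : Type*} [CommRing A] [Algebra C A]

/-- The part of length `k` of the quasi-shuffle product of weight `lam` of the words
`a 0, …, a (m - 1)` and `b 0, …, b (n - 1)`: the sum over the pairs `(P, Q)` of sets of positions
that cover all `k` positions, the first word being spread over `P` and the second one over `Q`;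
each position in `P ∩ Q` contributes a factor `lam`. -/
noncomputable def coverSum (lam : C) (k m n : ℕ) (a b : ℕ → A) : ShPlus C A :=
  ∑ P : Finset (Fin k), ∑ Q : Finset (Fin k),
    if P ∪ Q = Finset.univ ∧ P.card = m ∧ Q.card = n then
      lam ^ (P ∩ Q).card • pureTensor C A (fun j => spread P a j * spread Q b j)
    else 0

theorem coverSum_comm (lam : C) (k m n : ℕ) (a b : ℕ → A) :
    coverSum lam k m n a b = coverSum lam k n m b a := by
  unfold coverSum
  rw [Finset.sum_comm]
  refine Finset.sum_congr rfl fun P _ => Finset.sum_congr rfl fun Q _ => ?_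
  simp only [Finset.union_comm Q P, Finset.inter_comm Q P, mul_comm (spread Q a _),
    and_comm (a := Q.card = m)]

/-- The empty word is a left identity. -/
theorem coverSum_zero_left (lam : C) (k n : ℕ) (a b : ℕ → A) :
    coverSum lam k 0 n a b =
      if k = n then pureTensor C A (spread (Finset.univ : Finset (Fin k)) b) else 0 := by
  unfold coverSum
  rw [Finset.sum_eq_single ∅, Finset.sum_eq_single Finset.univ]
  · have h : (fun j => spread ∅ a j * spread (Finset.univ : Finset (Fin k)) b j) =
        spread Finset.univ b := by
      funext j
      simp [spread]
    simp [h]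
  · intro Q _ hQ
    simp [hQ]
  · simp
  · intro P _ hP
    simp [hP]
  · simp

theorem coverSum_eq_zero_of_lt (lam : C) {k m n : ℕ} (h : m + n < k) (a b : ℕ → A) :
    coverSum lam k m n a b = 0 := by
  refine Finset.sum_eq_zero fun P _ => Finset.sum_eq_zero fun Q _ => if_neg ?_
  rintro ⟨h1, h2, h3⟩
  have := Finset.card_union_le P Q
  rw [h1, Finset.card_univ, Fintype.card_fin] at this
  omega

theorem coverSum_zero_succ (lam : C) (m n : ℕ) (a b : ℕ → A) :
    coverSum lam 0 (m + 1) n a b = 0 := by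
  refine Finset.sum_eq_zero fun P _ => Finset.sum_eq_zero fun Q _ => if_neg ?_
  rintro ⟨-, h2, -⟩
  rw [Finset.eq_empty_of_isEmpty P] at h2
  simp at h2

variable (C A) in
theorem shPrepend_tmul_pureTensor {m : ℕ} (c : A) (x : Fin m → A) :
    shPrepend C A (c ⊗ₜ[C] pureTensor C A x) =
      pureTensor C A (Fin.cons c x : Fin (m + 1) → A) := by
  have h (x : Fin 1 → A) (y : Fin m → A) :
      TensorPower.mulEquiv (PiTensorProduct.tprod C x ⊗ₜ[C] PiTensorProduct.tprod C y) =
      PiTensorProduct.tprod C (Fin.append x y) := TensorPower.tprod_mul_tprod C x y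
  simp [shPrepend, pureTensor, h, PiTensorProduct.subsingletonEquiv_symm_apply',
    TensorPower.cast_tprod]
  rw [Fin.append_left_eq_cons]
  congr 2

/-- The recursion of the quasi-shuffle product, sorted by length: the first position belongs to
`P` only, to `Q` only, or to both. -/
theorem coverSum_succ (lam : C) (k m n : ℕ) (a b : ℕ → A) :
    coverSum lam (k + 1) (m + 1) (n + 1) a b =
      shPrepend C A (a 0 ⊗ₜ coverSum lam k m (n + 1) (fun i => a (i + 1)) b) +
      shPrepend C A (b 0 ⊗ₜ coverSum lam k (m + 1) n a (fun i => b (i + 1))) +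
      lam • shPrepend C A ((a 0 * b 0) ⊗ₜ
        coverSum lam k m n (fun i => a (i + 1)) (fun i => b (i + 1))) := by
  have hU1 (P Q : Finset (Fin k)) : insert 0 (P.map (Fin.succEmb k)) ∪ Q.map (Fin.succEmb k) =
      Finset.univ ↔ P ∪ Q = Finset.univ := by
    simp [Finset.ext_iff, Fin.forall_fin_succ]
  have hU2 (P Q : Finset (Fin k)) : P.map (Fin.succEmb k) ∪ insert 0 (Q.map (Fin.succEmb k)) =
      Finset.univ ↔ P ∪ Q = Finset.univ := by
    simp [Finset.ext_iff, Fin.forall_fin_succ]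
  have hU3 (P Q : Finset (Fin k)) : insert 0 (P.map (Fin.succEmb k)) ∪
      insert 0 (Q.map (Fin.succEmb k)) = Finset.univ ↔ P ∪ Q = Finset.univ := by
    simp [Finset.ext_iff, Fin.forall_fin_succ]
  have hU0 (P Q : Finset (Fin k)) : ¬ P.map (Fin.succEmb k) ∪ Q.map (Fin.succEmb k) =
      Finset.univ := by
    simp [Finset.ext_iff, Fin.forall_fin_succ]
  have h0 (P : Finset (Fin k)) : (0 : Fin (k + 1)) ∉ P.map (Fin.succEmb k) := by simp
  have hc (P : Finset (Fin k)) : (insert 0 (P.map (Fin.succEmb k))).card = P.card + 1 := by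
    rw [Finset.card_insert_of_notMem (h0 P), Finset.card_map]
  have hm (c d : A) (x y : Fin k → A) : (fun j => (Fin.cons c x : Fin (k + 1) → A) j *
      (Fin.cons d y : Fin (k + 1) → A) j) = Fin.cons (c * d) (fun j => x j * y j) := by
    funext j
    refine Fin.cases ?_ (fun j => ?_) j <;> simp
  have hI1 (P Q : Finset (Fin k)) : (insert 0 (P.map (Fin.succEmb k)) ∩
      Q.map (Fin.succEmb k)).card = (P ∩ Q).card := by
    rw [Finset.insert_inter_of_notMem (h0 Q), ← Finset.map_inter, Finset.card_map]
  have hI2 (P Q : Finset (Fin k)) : (P.map (Fin.succEmb k) ∩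
      insert 0 (Q.map (Fin.succEmb k))).card = (P ∩ Q).card := by
    rw [Finset.inter_insert_of_notMem (h0 P), ← Finset.map_inter, Finset.card_map]
  have hI3 (P Q : Finset (Fin k)) : (insert 0 (P.map (Fin.succEmb k)) ∩
      insert 0 (Q.map (Fin.succEmb k))).card = (P ∩ Q).card + 1 := by
    rw [← Finset.insert_inter_distrib, ← Finset.map_inter, hc]
  unfold coverSum
  rw [sum_finset_fin_succ]
  simp only [TensorProduct.tmul_sum, map_sum, Finset.smul_sum, ← Finset.sum_add_distrib]
  refine Finset.sum_congr rfl fun P _ => ?_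
  rw [sum_finset_fin_succ]
  refine Finset.sum_congr rfl fun Q _ => ?_
  simp only [hU0, hU1, hU2, hU3, hI1, hI2, hI3, hc, Finset.card_map, spread_map_succ,
    spread_insert_zero, hm, one_mul, mul_one, false_and, if_false, zero_add, add_left_inj,
    ← shPrepend_tmul_pureTensor]
  simp only [apply_ite (fun w : ShPlus C A => (a 0) ⊗ₜ[C] w),
    apply_ite (fun w : ShPlus C A => (b 0) ⊗ₜ[C] w),
    apply_ite (fun w : ShPlus C A => (a 0 * b 0) ⊗ₜ[C] w),
    apply_ite (shPrepend C A), apply_ite (fun w : ShPlus C A => lam • w),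
    TensorProduct.tmul_smul, map_smul, TensorProduct.tmul_zero, map_zero, smul_zero, pow_succ',
    mul_smul]
  abel

end Cover

/-! ### Mixable shuffles and covering pairs -/

section BlockIndex

variable {N : ℕ} (T : Finset (Fin (N - 1)))

theorem blockIndex_zero (h : 0 < N) : (blockIndex T ⟨0, h⟩ : ℕ) = 0 := by
  simp [blockIndex]

/-- The position after the merging stays the same across the places of `T` and advances by one across
the others. -/
theorem blockIndex_succ (i : Fin (N - 1)) :
    (blockIndex T ⟨i + 1, by omega⟩ : ℕ) =
      blockIndex T ⟨i, by omega⟩ + if i ∈ T then 0 else 1 := by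
  have h (k : Fin (N - 1)) : (k : ℕ) < i + 1 ↔ k = i ∨ (k : ℕ) < i := by
    rw [Fin.ext_iff]
    omega
  simp only [blockIndex, h, and_or_left, Finset.filter_or]
  by_cases hi : i ∈ T
  · rw [if_pos hi, add_zero, Finset.filter_false_of_mem, Finset.empty_union]
    rintro k - ⟨hk, rfl⟩
    exact hk hi
  · have h1 : (Finset.univ.filter fun k : Fin (N - 1) => k ∉ T ∧ k = i) = {i} := by
      ext k
      simp only [Finset.mem_filter, Finset.mem_univ, true_and, Finset.mem_singleton]
      exact ⟨fun h => h.2, fun h => ⟨h ▸ hi, h⟩⟩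
    rw [h1, if_neg hi, Finset.card_union_of_disjoint (by simp), Finset.card_singleton, add_comm]

theorem blockIndex_mono : Monotone (blockIndex T) := by
  intro i j hij
  rw [Fin.le_def] at hij ⊢
  simp only [blockIndex]
  refine Finset.card_le_card fun k hk => ?_
  simp only [Finset.mem_filter, Finset.mem_univ, true_and] at hk ⊢
  exact ⟨hk.1, by omega⟩

theorem blockIndex_last (h : 0 < N) : (blockIndex T ⟨N - 1, by omega⟩ : ℕ) + 1 = N - T.card := by
  have h1 : (Finset.univ.filter fun k : Fin (N - 1) => k ∉ T ∧ (k : ℕ) < N - 1) = Tᶜ := by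
    ext k
    simp
  have h2 := Finset.card_le_univ T
  simp only [blockIndex, h1, Finset.card_compl, Fintype.card_fin] at h2 ⊢
  omega

theorem mem_iff_blockIndex_eq (i : Fin (N - 1)) :
    i ∈ T ↔ (blockIndex T ⟨i, by omega⟩ : ℕ) = blockIndex T ⟨i + 1, by omega⟩ := by
  rw [blockIndex_succ]
  by_cases h : i ∈ T <;> simp [h]

theorem blockIndex_surjective : Function.Surjective (blockIndex T) := by
  have key (i : ℕ) (hi : i < N) (j : ℕ) (hj : j ≤ blockIndex T ⟨i, hi⟩) :
      ∃ l, (blockIndex T l : ℕ) = j := by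
    induction i with
    | zero =>
      rw [blockIndex_zero] at hj
      exact ⟨⟨0, hi⟩, by rw [blockIndex_zero]; omega⟩
    | succ i ih =>
      by_cases h : j ≤ blockIndex T ⟨i, by omega⟩
      · exact ih (by omega) h
      · refine ⟨⟨i + 1, hi⟩, ?_⟩
        have := blockIndex_succ T ⟨i, by omega⟩
        simp only at this
        split_ifs at this <;> omega
  intro j
  have hN : 0 < N := by have := j.isLt; omega
  have := blockIndex_last T hN
  obtain ⟨l, hl⟩ := key (N - 1) (by omega) j (by omega)
  exact ⟨l, Fin.ext hl⟩

end BlockIndex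

section MixableShuffle

variable {m n : ℕ}

/-- Two entries that are merged come from different words, the one from the first word coming
first. In particular no more than two entries are merged into one. -/
theorem of_blockIndex_eq {σ : Equiv.Perm (Fin (m + n))} {T : Finset (Fin (m + n - 1))}
    (hT : (T : Set (Fin (m + n - 1))) ⊆ admissible m n σ) {i j : Fin (m + n)} (hij : i < j)
    (h : blockIndex T i = blockIndex T j) : (σ i : ℕ) < m ∧ m ≤ (σ j : ℕ) := by
  rw [Fin.lt_def] at hij
  -- `blockIndex T` is constant from `i` to `j`, so all the places in between are merged
  have step (l : Fin (m + n - 1)) (h1 : i ≤ ⟨l, by omega⟩) (h2 : ⟨l + 1, by omega⟩ ≤ j) :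
      l ∈ T := by
    rw [mem_iff_blockIndex_eq]
    have h3 := blockIndex_mono T h1
    have h4 := blockIndex_mono T h2
    have h5 : (⟨l, by omega⟩ : Fin (m + n)) ≤ ⟨l + 1, by omega⟩ := by simp [Fin.le_def]
    have h6 := blockIndex_mono T h5
    rw [← h] at h4
    exact congrArg Fin.val (le_antisymm h6 (h4.trans h3))
  have h1 := hT (step ⟨i, by omega⟩ le_rfl (by rw [Fin.le_def]; simp only; omega))
  by_cases hj : (i : ℕ) + 1 = j
  · have hj' : j = ⟨i + 1, by omega⟩ := Fin.ext hj.symm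
    rw [hj']
    exact h1
  -- two consecutive merged places would put the entry between them into both words
  · have h2 := hT (step ⟨i + 1, by omega⟩ (by rw [Fin.le_def]; simp)
      (by rw [Fin.le_def]; simp only; omega))
    exact absurd h2.1 (not_lt.2 h1.2)

namespace MixableShuffle

variable (p : MixableShuffle m n)

/-- The position, in the merged word, of a letter of either word. -/
def pos (l : Fin (m + n)) : Fin (m + n - p.1.2.card) := blockIndex p.1.2 (p.1.1.symm l)

theorem pos_left_strictMono : StrictMono fun i : Fin m => p.pos (Fin.castAdd n i) := by
  intro i j hij
  have h := p.2.1.1 hij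
  refine lt_of_le_of_ne (blockIndex_mono _ h.le) fun heq => ?_
  have := (of_blockIndex_eq p.2.2 h heq).2
  simp only [Equiv.apply_symm_apply, Fin.val_castAdd] at this
  omega

theorem pos_right_strictMono : StrictMono fun i : Fin n => p.pos (Fin.natAdd m i) := by
  intro i j hij
  have h := p.2.1.2 hij
  refine lt_of_le_of_ne (blockIndex_mono _ h.le) fun heq => ?_
  have := (of_blockIndex_eq p.2.2 h heq).1
  simp only [Equiv.apply_symm_apply, Fin.val_natAdd] at this
  omega

theorem pos_surjective : Function.Surjective p.pos :=
  (blockIndex_surjective _).comp p.1.1.symm.surjective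

/-- The positions, in the merged word, of the letters of the first word. -/
def leftSet : Finset (Fin (m + n - p.1.2.card)) :=
  Finset.univ.image fun i : Fin m => p.pos (Fin.castAdd n i)

/-- The positions, in the merged word, of the letters of the second word. -/
def rightSet : Finset (Fin (m + n - p.1.2.card)) :=
  Finset.univ.image fun i : Fin n => p.pos (Fin.natAdd m i)

theorem card_leftSet : p.leftSet.card = m := by
  rw [leftSet, Finset.card_image_of_injective _ p.pos_left_strictMono.injective, Finset.card_fin]

theorem card_rightSet : p.rightSet.card = n := by
  rw [rightSet, Finset.card_image_of_injective _ p.pos_right_strictMono.injective,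
    Finset.card_fin]

theorem leftSet_union_rightSet : p.leftSet ∪ p.rightSet = Finset.univ := by
  refine Finset.eq_univ_of_forall fun j => ?_
  obtain ⟨l, rfl⟩ := p.pos_surjective j
  refine Fin.addCases (fun i => ?_) (fun i => ?_) l
  · exact Finset.mem_union_left _ (Finset.mem_image_of_mem _ (Finset.mem_univ i))
  · exact Finset.mem_union_right _ (Finset.mem_image_of_mem _ (Finset.mem_univ i))

theorem card_leftSet_inter_rightSet : (p.leftSet ∩ p.rightSet).card = p.1.2.card := by
  have h1 := Finset.card_union_add_card_inter p.leftSet p.rightSet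
  have h2 := Finset.card_le_univ p.1.2
  rw [leftSet_union_rightSet, card_leftSet, card_rightSet, Finset.card_univ] at h1
  simp only [Fintype.card_fin] at h1 h2
  omega

/-- Merging the shuffled letters along `T` gives the product of the two spread words. -/
theorem prod_eq_spread_mul_spread {A : Type*} [CommMonoid A] (x : Fin m → A) (y : Fin n → A)
    (j : Fin (m + n - p.1.2.card)) :
    (∏ i : {i : Fin (m + n) // blockIndex p.1.2 i = j}, Fin.append x y (p.1.1 i)) =
      spread p.leftSet (extendOne x) j * spread p.rightSet (extendOne y) j := by
  rw [leftSet, rightSet, ← prod_ite_eq_spread p.pos_left_strictMono,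
    ← prod_ite_eq_spread p.pos_right_strictMono,
    ← Finset.prod_subtype (Finset.univ.filter fun i => blockIndex p.1.2 i = j) (by simp)
      (fun i => Fin.append x y (p.1.1 i)),
    Finset.prod_filter, ← Equiv.prod_comp p.1.1.symm, Fin.prod_univ_add]
  simp only [Equiv.apply_symm_apply, Fin.append_left, Fin.append_right]
  rfl

/-- A numerical encoding of the positions that tells the two words apart: `2 * pos` for a letter of the
first word, `2 * pos + 1` for a letter of the second one. It is increasing along the shuffled word,
and therefore determines the mixable shuffle. -/
def key (l : Fin (m + n)) : ℕ := 2 * p.pos l + if (l : ℕ) < m then 0 else 1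

theorem key_strictMono : StrictMono fun i => p.key (p.1.1 i) := by
  intro i j hij
  simp only [key, pos, Equiv.symm_apply_apply]
  rcases (blockIndex_mono p.1.2 hij.le).lt_or_eq with h | h
  · rw [Fin.lt_def] at h
    split_ifs <;> omega
  · have := of_blockIndex_eq p.2.2 hij h
    rw [h, if_pos this.1, if_neg (not_lt.2 this.2)]
    omega

theorem blockIndex_eq_key (i : Fin (m + n)) : (blockIndex p.1.2 i : ℕ) = p.key (p.1.1 i) / 2 := by
  simp only [key, pos, Equiv.symm_apply_apply]
  split_ifs <;> omega

theorem eq_of_key_eq {p q : MixableShuffle m n} (h : p.key = q.key) : p = q := by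
  have hσ : p.1.1 = q.1.1 := by
    have h1 := p.key_strictMono
    have h2 := q.key_strictMono
    rw [← h] at h2
    have hinj : Function.Injective p.key := by
      have := h1.injective.comp p.1.1.symm.injective
      simpa [Function.comp_def] using this
    have h3 := (StrictMono.range_inj h1 h2).1 (by
      rw [← Function.comp_def p.key, ← Function.comp_def p.key, p.1.1.surjective.range_comp,
        q.1.1.surjective.range_comp])
    exact Equiv.ext fun i => hinj (congrFun h3 i)
  refine Subtype.ext (Prod.ext hσ (Finset.ext fun i => ?_))
  rw [mem_iff_blockIndex_eq, mem_iff_blockIndex_eq, blockIndex_eq_key, blockIndex_eq_key,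
    blockIndex_eq_key, blockIndex_eq_key, h, hσ]

/-- The length of the merged word, and the positions taken by each of the two words. -/
def cover : Σ k : ℕ, Finset (Fin k) × Finset (Fin k) :=
  ⟨m + n - p.1.2.card, p.leftSet, p.rightSet⟩

theorem cover_injective : Function.Injective (cover : MixableShuffle m n → _) := by
  intro p q hpq
  have hl : p.leftSet.map Fin.valEmbedding = q.leftSet.map Fin.valEmbedding :=
    congrArg (fun s : Σ k : ℕ, Finset (Fin k) × Finset (Fin k) =>
      s.2.1.map Fin.valEmbedding) hpq
  have hr : p.rightSet.map Fin.valEmbedding = q.rightSet.map Fin.valEmbedding :=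
    congrArg (fun s : Σ k : ℕ, Finset (Fin k) × Finset (Fin k) =>
      s.2.2.map Fin.valEmbedding) hpq
  have hl' := (StrictMono.range_inj (Fin.val_strictMono.comp p.pos_left_strictMono)
    (Fin.val_strictMono.comp q.pos_left_strictMono)).1 (by
      simpa [leftSet, Set.range_comp] using congrArg (fun s : Finset ℕ => (s : Set ℕ)) hl)
  have hr' := (StrictMono.range_inj (Fin.val_strictMono.comp p.pos_right_strictMono)
    (Fin.val_strictMono.comp q.pos_right_strictMono)).1 (by
      simpa [rightSet, Set.range_comp] using congrArg (fun s : Finset ℕ => (s : Set ℕ)) hr)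
  refine eq_of_key_eq (funext fun l => ?_)
  unfold key
  congr 2
  refine Fin.addCases (fun i => ?_) (fun i => ?_) l
  · exact congrFun hl' i
  · exact congrFun hr' i

end MixableShuffle

/-- Pairs of sets of positions may be compared as sets of natural numbers. -/
theorem sigma_finset_prod_ext {k l : ℕ} {P Q : Finset (Fin k)} {P' Q' : Finset (Fin l)}
    (h : k = l) (hP : P.map Fin.valEmbedding = P'.map Fin.valEmbedding)
    (hQ : Q.map Fin.valEmbedding = Q'.map Fin.valEmbedding) :
    (⟨k, P, Q⟩ : Σ k : ℕ, Finset (Fin k) × Finset (Fin k)) = ⟨l, P', Q'⟩ := by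
  subst h
  rw [Finset.map_injective _ hP, Finset.map_injective _ hQ]

/-- Every covering pair comes from a mixable shuffle: sort all the letters by their positions, the
letter of the first word going first when two letters share a position. -/
theorem MixableShuffle.exists_cover_eq {k : ℕ} {P Q : Finset (Fin k)} (hPQ : P ∪ Q = Finset.univ)
    (hP : P.card = m) (hQ : Q.card = n) : ∃ p : MixableShuffle m n, p.cover = ⟨k, P, Q⟩ := by
  set f := P.orderEmbOfFin hP with hf
  set g := Q.orderEmbOfFin hQ with hg
  set key : Fin (m + n) → ℕ := Fin.addCases (fun i => 2 * (f i : ℕ)) (fun i => 2 * (g i : ℕ) + 1)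
    with hkey
  have keyl (i : Fin m) : key (Fin.castAdd n i) = 2 * (f i : ℕ) := by simp [hkey]
  have keyr (i : Fin n) : key (Fin.natAdd m i) = 2 * (g i : ℕ) + 1 := by simp [hkey]
  have key_inj : Function.Injective key := by
    intro l l'
    refine Fin.addCases (fun i => ?_) (fun i => ?_) l <;>
      refine Fin.addCases (fun i' => ?_) (fun i' => ?_) l' <;>
      simp only [keyl, keyr] <;> intro h
    · rw [f.injective (Fin.ext (show (f i : ℕ) = f i' by omega))]
    · omega
    · omega
    · rw [g.injective (Fin.ext (show (g i : ℕ) = g i' by omega))]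
  have key_even (l : Fin (m + n)) (h : key l % 2 = 0) : (l : ℕ) < m := by
    revert h
    refine Fin.addCases (fun i => ?_) (fun i => ?_) l <;> simp only [keyl, keyr] <;> intro h
    · simp
    · omega
  have key_odd (l : Fin (m + n)) (h : key l % 2 = 1) : m ≤ (l : ℕ) := by
    revert h
    refine Fin.addCases (fun i => ?_) (fun i => ?_) l <;> simp only [keyl, keyr] <;> intro h
    · omega
    · simp
  have key_lt (l : Fin (m + n)) : key l / 2 < k := by
    refine Fin.addCases (fun i => ?_) (fun i => ?_) l <;> simp only [keyl, keyr]
    · have := (f i).isLt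
      omega
    · have := (g i).isLt
      omega
  have key_surj (j : ℕ) (hj : j < k) : ∃ l, key l / 2 = j := by
    have : (⟨j, hj⟩ : Fin k) ∈ P ∪ Q := hPQ ▸ Finset.mem_univ _
    rcases Finset.mem_union.1 this with h | h
    · obtain ⟨i, hi⟩ : (⟨j, hj⟩ : Fin k) ∈ Set.range f := by
        rwa [hf, Finset.range_orderEmbOfFin]
      refine ⟨Fin.castAdd n i, ?_⟩
      rw [keyl, hi]
      simp
    · obtain ⟨i, hi⟩ : (⟨j, hj⟩ : Fin k) ∈ Set.range g := by
        rwa [hg, Finset.range_orderEmbOfFin]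
      refine ⟨Fin.natAdd m i, ?_⟩
      rw [keyr, hi]
      simp only
      omega
  -- `key` is injective, so sorting the letters by it makes it strictly increasing
  set σ := Tuple.sort key
  have hσ : StrictMono (key ∘ σ) :=
    (Tuple.monotone_sort key).strictMono_of_injective (key_inj.comp σ.injective)
  have hσ_symm {l l' : Fin (m + n)} (h : key l < key l') : σ.symm l < σ.symm l' := by
    rw [← hσ.lt_iff_lt]
    simpa using h
  have hc_mono {i j : Fin (m + n)} (h : i ≤ j) : key (σ i) / 2 ≤ key (σ j) / 2 :=
    Nat.div_le_div_right (hσ.monotone h)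
  set T := Finset.univ.filter fun i : Fin (m + n - 1) =>
    key (σ ⟨i, by omega⟩) / 2 = key (σ ⟨i + 1, by omega⟩) / 2 with hT
  -- no position is skipped, because every position carries a letter
  have hstep (i : ℕ) (hi : i + 1 < m + n) :
      key (σ ⟨i + 1, hi⟩) / 2 ≤ key (σ ⟨i, by omega⟩) / 2 + 1 := by
    by_contra! h
    obtain ⟨l, hl⟩ := key_surj (key (σ ⟨i, by omega⟩) / 2 + 1) (h.trans (key_lt _))
    obtain ⟨i', rfl⟩ := σ.surjective l
    rcases le_or_gt (i' : ℕ) i with h' | h'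
    · have := hc_mono (show i' ≤ ⟨i, by omega⟩ from h')
      omega
    · have := hc_mono (show ⟨i + 1, hi⟩ ≤ i' from h')
      omega
  have hblock (i : ℕ) (hi : i < m + n) : (blockIndex T ⟨i, hi⟩ : ℕ) = key (σ ⟨i, hi⟩) / 2 := by
    induction i with
    | zero =>
      rw [blockIndex_zero]
      obtain ⟨l, hl⟩ := key_surj 0 (lt_of_le_of_lt (Nat.zero_le _) (key_lt ⟨0, hi⟩))
      obtain ⟨i', rfl⟩ := σ.surjective l
      have := hc_mono (show ⟨0, hi⟩ ≤ i' from Nat.zero_le _)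
      omega
    | succ i ih =>
      have h1 := blockIndex_succ T ⟨i, by omega⟩
      have h2 := hstep i hi
      have h3 := hc_mono (show (⟨i, by omega⟩ : Fin (m + n)) ≤ ⟨i + 1, hi⟩ from Nat.le_succ i)
      have h4 := ih (by omega)
      simp only [hT, Finset.mem_filter, Finset.mem_univ, true_and] at h1
      rw [h1, h4]
      split_ifs with h5 <;> omega
  -- both `blockIndex T` and `key (σ ·) / 2` are onto their ranges `{0, …, m + n - |T| - 1}` and
  -- `{0, …, k - 1}`
  have hcard : m + n - T.card = k := by
    rcases lt_trichotomy (m + n - T.card) k with h | h | h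
    · obtain ⟨l, hl⟩ := key_surj _ h
      obtain ⟨i, rfl⟩ := σ.surjective l
      have h1 := hblock i i.isLt
      have h2 := (blockIndex T i).isLt
      simp only [Fin.eta] at h1
      omega
    · exact h
    · obtain ⟨i, hi⟩ := blockIndex_surjective T ⟨k, h⟩
      have h1 := hblock i i.isLt
      have h2 := key_lt (σ i)
      simp only [Fin.eta, hi] at h1
      omega
  refine ⟨⟨(σ, T), ⟨fun i j hij => hσ_symm ?_, fun i j hij => hσ_symm ?_⟩, fun i hi => ?_⟩, ?_⟩
  · have : f i < f j := f.strictMono hij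
    rw [Fin.lt_def] at this
    rw [keyl, keyl]
    omega
  · have : g i < g j := g.strictMono hij
    rw [Fin.lt_def] at this
    rw [keyr, keyr]
    omega
  · have h1 : key (σ ⟨i, by omega⟩) / 2 = key (σ ⟨i + 1, by omega⟩) / 2 := by
      simpa [hT] using hi
    have h2 : key (σ ⟨i, by omega⟩) < key (σ ⟨i + 1, by omega⟩) :=
      hσ (show (⟨i, by omega⟩ : Fin (m + n)) < ⟨i + 1, by omega⟩ from Nat.lt_succ_self i)
    exact ⟨key_even (σ ⟨i, by omega⟩) (by omega), key_odd (σ ⟨i + 1, by omega⟩) (by omega)⟩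
  · have hpos (l : Fin (m + n)) : (blockIndex T (σ.symm l) : ℕ) = key l / 2 := by
      have := hblock (σ.symm l) (σ.symm l).isLt
      simpa using this
    refine sigma_finset_prod_ext hcard ?_ ?_
    · refine Eq.trans ?_ (congrArg (Finset.map Fin.valEmbedding)
        (Finset.image_orderEmbOfFin_univ P hP))
      ext j
      simp [MixableShuffle.leftSet, MixableShuffle.pos, hpos, keyl, ← hf]
    · refine Eq.trans ?_ (congrArg (Finset.map Fin.valEmbedding)
        (Finset.image_orderEmbOfFin_univ Q hQ))
      ext j
      simp [MixableShuffle.rightSet, MixableShuffle.pos, hpos, keyr, ← hg, Nat.mul_add_div]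

end MixableShuffle

/-- The mixable shuffle product, indexed by covering pairs of sets of positions rather than by
mixable shuffles. -/
theorem shPlusMul_eq_sum_coverSum {C : Type*} [CommRing C] {A : Type*} [CommRing A] [Algebra C A]
    (lam : C) {m n : ℕ} (x : Fin m → A) (y : Fin n → A) :
    shPlusMul A lam (pureTensor C A x) (pureTensor C A y) =
      ∑ k ∈ Finset.range (m + n + 1), coverSum lam k m n (extendOne x) (extendOne y) := by
  have hR (k : ℕ) : coverSum lam k m n (extendOne x) (extendOne y) =
      ∑ s : Finset (Fin k) × Finset (Fin k) with
        s.1 ∪ s.2 = Finset.univ ∧ s.1.card = m ∧ s.2.card = n,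
        lam ^ (s.1 ∩ s.2).card •
          pureTensor C A (fun j => spread s.1 (extendOne x) j * spread s.2 (extendOne y) j) := by
    rw [Finset.sum_filter, Fintype.sum_prod_type]
    rfl
  simp only [hR]
  rw [shPlusMul_pureTensor, Finset.sum_sigma']
  refine Finset.sum_bij (fun p _ => p.cover) (fun p _ => ?_)
    (fun p _ q _ h => MixableShuffle.cover_injective h) (fun s hs => ?_) (fun p _ => ?_)
  · simp only [MixableShuffle.cover, Finset.mem_sigma, Finset.mem_range, Finset.mem_filter,
      Finset.mem_univ, true_and]
    exact ⟨by omega, p.leftSet_union_rightSet, p.card_leftSet, p.card_rightSet⟩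
  · obtain ⟨k, P, Q⟩ := s
    simp only [Finset.mem_sigma, Finset.mem_filter] at hs
    obtain ⟨p, hp⟩ := MixableShuffle.exists_cover_eq hs.2.2.1 hs.2.2.2.1 hs.2.2.2.2
    exact ⟨p, Finset.mem_univ p, hp⟩
  · simp only [MixableShuffle.cover, p.prod_eq_spread_mul_spread]
    exact congrArg (fun e => lam ^ e • pureTensor C A _) p.card_leftSet_inter_rightSet.symm

/-! ### The mixable shuffle algebra -/

section ShuffleAlgebra

variable {C : Type*} [CommRing C] {A : Type*} [CommRing A] [Algebra C A]

variable (C A) in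
/-- The tensor of length `0`, which is the identity of the mixable shuffle algebra. -/
noncomputable def shPlusOne : ShPlus C A := pureTensor C A (fun i : Fin 0 => i.elim0)

theorem pureTensor_fin_zero (x : Fin 0 → A) : pureTensor C A x = shPlusOne C A :=
  congrArg (pureTensor C A) (Subsingleton.elim _ _)

theorem pureTensor_succ {n : ℕ} (x : Fin (n + 1) → A) :
    pureTensor C A x = shPrepend C A (x 0 ⊗ₜ pureTensor C A (Fin.tail x)) := by
  rw [shPrepend_tmul_pureTensor, Fin.cons_self_tail]

theorem shPlus_induction_pureTensor {motive : ShPlus C A → Prop} (zero : motive 0)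
    (pure : ∀ {n : ℕ} (x : Fin n → A), motive (pureTensor C A x))
    (add : ∀ v w, motive v → motive w → motive (v + w))
    (smul : ∀ (c : C) (w), motive w → motive (c • w)) (w : ShPlus C A) : motive w := by
  induction w using DirectSum.induction_on with
  | zero => exact zero
  | add v w hv hw => exact add v w hv hw
  | of n w =>
    rw [← DirectSum.lof_eq_of C]
    induction w using PiTensorProduct.induction_on with
    | smul_tprod r x =>
      rw [map_smul]
      exact smul r _ (pure x)
    | add v w hv hw =>
      rw [map_add]
      exact add _ _ hv hw

/-- The module `⨁ₖ A^{⊗k}` is spanned by what arises from the tensor of length `0` by repeatedly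
prepending a letter. -/
theorem shPlus_induction {motive : ShPlus C A → Prop} (zero : motive 0)
    (one : motive (shPlusOne C A))
    (prepend : ∀ (a : A) (w), motive w → motive (shPrepend C A (a ⊗ₜ w)))
    (add : ∀ v w, motive v → motive w → motive (v + w))
    (smul : ∀ (c : C) (w), motive w → motive (c • w)) (w : ShPlus C A) : motive w := by
  refine shPlus_induction_pureTensor zero (fun {n} x => ?_) add smul w
  induction n with
  | zero =>
    rw [pureTensor_fin_zero]
    exact one
  | succ n ih =>
    rw [pureTensor_succ]
    exact prepend _ _ (ih _)

theorem shPlusMul_comm (lam : C) (v w : ShPlus C A) :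
    shPlusMul A lam v w = shPlusMul A lam w v := by
  induction v using shPlus_induction_pureTensor with
  | zero => simp
  | add v v' hv hv' => simp [hv, hv']
  | smul c v hv => simp [hv]
  | @pure m x =>
    induction w using shPlus_induction_pureTensor with
    | zero => simp
    | add v v' hv hv' => simp [hv, hv']
    | smul c v hv => simp [hv]
    | pure y =>
      rw [shPlusMul_eq_sum_coverSum, shPlusMul_eq_sum_coverSum]
      refine Finset.sum_congr (by rw [Nat.add_comm m]) fun k _ => coverSum_comm _ _ _ _ _ _

theorem shPlusOne_mul (lam : C) (w : ShPlus C A) : shPlusMul A lam (shPlusOne C A) w = w := by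
  induction w using shPlus_induction_pureTensor with
  | zero => simp
  | add v v' hv hv' => simp [hv, hv']
  | smul c v hv => simp [hv]
  | @pure n y =>
    rw [shPlusOne, shPlusMul_eq_sum_coverSum, Finset.sum_eq_single n]
    · rw [coverSum_zero_left, if_pos rfl, spread_univ]
    · intro k _ hk
      rw [coverSum_zero_left, if_neg hk]
    · simp

/-- The recursion of the quasi-shuffle product: the first tensor factor of a product of two tensors
is the first factor of the left one, that of the right one, or the product of both. -/
theorem shPlusMul_prepend (lam : C) (a b : A) (v w : ShPlus C A) :
    shPlusMul A lam (shPrepend C A (a ⊗ₜ v)) (shPrepend C A (b ⊗ₜ w)) =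
      shPrepend C A (a ⊗ₜ shPlusMul A lam v (shPrepend C A (b ⊗ₜ w))) +
      shPrepend C A (b ⊗ₜ shPlusMul A lam (shPrepend C A (a ⊗ₜ v)) w) +
      lam • shPrepend C A ((a * b) ⊗ₜ shPlusMul A lam v w) := by
  induction v using shPlus_induction_pureTensor with
  | zero => simp
  | add v v' hv hv' =>
    simp only [TensorProduct.tmul_add, map_add, LinearMap.add_apply, smul_add, hv, hv']
    abel
  | smul c v hv =>
    simp only [TensorProduct.tmul_smul, map_smul, LinearMap.smul_apply, hv, smul_add]
    rw [smul_comm lam c]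
  | @pure m x =>
    induction w using shPlus_induction_pureTensor with
    | zero => simp
    | add v v' hv hv' =>
      simp only [TensorProduct.tmul_add, map_add, smul_add, hv, hv']
      abel
    | smul c v hv =>
      simp only [TensorProduct.tmul_smul, map_smul, hv, smul_add]
      rw [smul_comm lam c]
    | @pure n y =>
      simp only [shPrepend_tmul_pureTensor, shPlusMul_eq_sum_coverSum]
      rw [Finset.sum_range_succ', coverSum_zero_succ, add_zero, ← add_assoc (m + 1) n 1]
      simp only [coverSum_succ, extendOne_cons_zero, extendOne_cons_succ, Finset.sum_add_distrib,
        TensorProduct.tmul_sum, map_sum, Finset.smul_sum]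
      refine congrArg₂ _ (congrArg₂ _ ?_ rfl) ?_
      · rw [show m + 1 + n + 1 = m + (n + 1) + 1 by ring]
      -- the product of the tails has length at most `m + n`, so its last summand vanishes
      rw [show m + 1 + n + 1 = m + n + 1 + 1 by ring, Finset.sum_range_succ _ (m + n + 1),
        coverSum_eq_zero_of_lt lam (lt_add_one (m + n))]
      simp

theorem shPlusMul_assoc (lam : C) (u v w : ShPlus C A) :
    shPlusMul A lam (shPlusMul A lam u v) w = shPlusMul A lam u (shPlusMul A lam v w) := by
  induction u using shPlus_induction generalizing v w with
  | zero => simp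
  | add u u' hu hu' => simp [hu, hu']
  | smul c u hu => simp [hu]
  | one => simp [shPlusOne_mul]
  | prepend a u hu =>
    induction v using shPlus_induction generalizing w with
    | zero => simp
    | add u u' hu hu' => simp [hu, hu']
    | smul c u hu => simp [hu]
    | one => rw [shPlusMul_comm lam _ (shPlusOne C A), shPlusOne_mul, shPlusOne_mul]
    | prepend b v hv =>
      induction w using shPlus_induction with
      | zero => simp
      | add u u' hu hu' => simp [hu, hu']
      | smul c u hu => simp [hu]
      | one => rw [shPlusMul_comm lam _ (shPlusOne C A), shPlusOne_mul,
          shPlusMul_comm lam _ (shPlusOne C A), shPlusOne_mul]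
      | prepend c w hw =>
        have hvw := shPlusMul_prepend lam b c v w
        -- The recursion expands both sides into products of smaller total length. The three terms
        -- starting with `c` recombine into `((a ⊗ u)(b ⊗ v)) w`, which is the hypothesis `hw`.
        have hu' := hu (shPrepend C A (b ⊗ₜ v)) (shPrepend C A (c ⊗ₜ w))
        rw [hvw] at hu'
        rw [shPlusMul_prepend lam a b u v] at hw ⊢
        simp only [map_add, LinearMap.add_apply, map_smul, LinearMap.smul_apply] at hu' hw
        rw [hvw]
        simp only [map_add, LinearMap.add_apply, map_smul, LinearMap.smul_apply,
          shPlusMul_prepend lam _ c _ w]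
        rw [hu', hu, hu, hu, hv, hv]
        simp only [shPlusMul_prepend lam a _ u _]
        rw [← hw]
        simp only [TensorProduct.tmul_add, TensorProduct.tmul_smul, map_add, map_smul, smul_add,
          mul_assoc]
        abel

theorem shMul_tmul (lam : C) (a b : A) (v w : ShPlus C A) :
    shMul A lam (a ⊗ₜ v) (b ⊗ₜ w) = (a * b) ⊗ₜ shPlusMul A lam v w := rfl

theorem shOp_tmul (a : A) (w : ShPlus C A) :
    shOp C A (a ⊗ₜ w) = 1 ⊗ₜ shPrepend C A (a ⊗ₜ w) := rfl

variable (A) in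
theorem sh_isBaxterAlgebra (lam : C) : IsBaxterAlgebra lam (shMul A lam) (shOp C A) where
  mul_assoc x y z := by
    induction x using TensorProduct.induction_on with
    | zero => simp
    | add x x' hx hx' => simp [hx, hx']
    | tmul a u =>
      induction y using TensorProduct.induction_on with
      | zero => simp
      | add x x' hx hx' => simp [hx, hx']
      | tmul b v =>
        induction z using TensorProduct.induction_on with
        | zero => simp
        | add x x' hx hx' => simp [hx, hx']
        | tmul c w => simp only [shMul_tmul, mul_assoc, shPlusMul_assoc]
  mul_comm x y := by
    induction x using TensorProduct.induction_on with
    | zero => simp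
    | add x x' hx hx' => simp [hx, hx']
    | tmul a u =>
      induction y using TensorProduct.induction_on with
      | zero => simp
      | add x x' hx hx' => simp [hx, hx']
      | tmul b v => rw [shMul_tmul, shMul_tmul, mul_comm, shPlusMul_comm]
  baxter x y := by
    induction x using TensorProduct.induction_on with
    | zero => simp
    | add x x' hx hx' =>
      simp only [map_add, LinearMap.add_apply, smul_add, hx, hx']
      abel
    | tmul a u =>
      induction y using TensorProduct.induction_on with
      | zero => simp
      | add x x' hx hx' =>
        simp only [map_add, LinearMap.add_apply, smul_add, hx, hx']
        abel
      | tmul b v =>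
        simp only [shOp_tmul, shMul_tmul, mul_one, shPlusMul_prepend,
          TensorProduct.tmul_add, TensorProduct.tmul_smul]
        rw [shPlusMul_comm lam v]

end ShuffleAlgebra

/-! ### The comparison map is multiplicative -/

section Comparison

variable {X : Type*} {C : Type*} [CommRing C]

theorem dite_orderIsoOfFin_eq_spread {A : Type*} [CommMonoid A] {m k : ℕ} (P : Finset (Fin k))
    (hP : P.card = m) (a : Fin m → A) (j : Fin k) :
    (if h : j ∈ P then a ((P.orderIsoOfFin hP).symm ⟨j, h⟩) else 1) =
      spread P (extendOne a) j := by
  have hs := prod_ite_eq_spread (P.orderEmbOfFin hP).strictMono a j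
  rw [Finset.image_orderEmbOfFin_univ] at hs
  rw [← hs]
  split_ifs with h
  · obtain ⟨i, rfl⟩ : j ∈ Set.range (P.orderEmbOfFin hP) := by
      rwa [Finset.range_orderEmbOfFin]
    have hi : (P.orderIsoOfFin hP).symm ⟨P.orderEmbOfFin hP i, h⟩ = i := by
      rw [OrderIso.symm_apply_eq]
      exact Subtype.ext rfl
    simp [hi]
  · refine (Finset.prod_eq_one fun i _ => if_neg ?_).symm
    rintro rfl
    exact h (P.orderEmbOfFin_mem hP i)

theorem map_spread_extendOne {A B : Type*} [Monoid A] [Monoid B] (e : A →* B) {m k : ℕ}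
    (P : Finset (Fin k)) (a : Fin m → A) (j : Fin k) :
    e (spread P (extendOne a) j) = spread P (extendOne fun i => e (a i)) j := by
  unfold spread extendOne
  split_ifs <;> simp

/-- The entries of Cartier's merged word are the products of the two spread words. -/
theorem map_cartierPhi {B : Type*} [CommMonoid B] (e : FreeCommMon X →* B) {m n k : ℕ}
    (p : CartierPair m n k) (a : Fin m → FreeCommMon X) (b : Fin n → FreeCommMon X) (j : Fin k) :
    e (cartierPhi p a b j) = spread p.1.1 (extendOne fun i => e (a i)) j *
      spread p.1.2 (extendOne fun i => e (b i)) j := by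
  rw [cartierPhi, dite_orderIsoOfFin_eq_spread, dite_orderIsoOfFin_eq_spread, map_mul,
    map_spread_extendOne, map_spread_extendOne]

/-- In weight `-1` the sum over covering pairs is Cartier's, as `|P ∩ Q| ≡ k + m + n` modulo `2`. -/
theorem coverSum_neg_one {A : Type*} [CommRing A] [Algebra C A] (e : FreeCommMon X →* A)
    (k : ℕ) {m n : ℕ} (a : Fin m → FreeCommMon X) (b : Fin n → FreeCommMon X) :
    coverSum (-1 : C) k m n (extendOne fun i => e (a i)) (extendOne fun i => e (b i)) =
      ∑ p : CartierPair m n k,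
        (-1 : C) ^ (k + m + n) • pureTensor C A (fun j => e (cartierPhi p a b j)) := by
  have hsign (p : CartierPair m n k) : (-1 : C) ^ (k + m + n) = (-1) ^ (p.1.1 ∩ p.1.2).card := by
    have h := Finset.card_union_add_card_inter p.1.1 p.1.2
    rw [p.2.1, p.2.2.1, p.2.2.2, Finset.card_univ, Fintype.card_fin] at h
    rw [show k + m + n = 2 * k + (p.1.1 ∩ p.1.2).card by omega, pow_add, pow_mul]
    simp
  have hterm (p : CartierPair m n k) :
      (-1 : C) ^ (k + m + n) • pureTensor C A (fun j => e (cartierPhi p a b j)) =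
        (-1 : C) ^ (p.1.1 ∩ p.1.2).card • pureTensor C A (fun j =>
          spread p.1.1 (extendOne fun i => e (a i)) j *
            spread p.1.2 (extendOne fun i => e (b i)) j) := by
    simp only [map_cartierPhi, hsign p]
  rw [Finset.sum_congr rfl fun p _ => hterm p]
  rw [← Finset.sum_subtype (Finset.univ.filter fun s : Finset (Fin k) × Finset (Fin k) =>
    s.1 ∪ s.2 = Finset.univ ∧ s.1.card = m ∧ s.2.card = n) (by simp) (fun s =>
      (-1 : C) ^ (s.1 ∩ s.2).card • pureTensor C A (fun j =>
        spread s.1 (extendOne fun i => e (a i)) j * spread s.2 (extendOne fun i => e (b i)) j)),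
    Finset.sum_filter, Fintype.sum_prod_type]
  rfl

variable (C)

theorem monomialTensor_eq {m : ℕ} (u : Fin (m + 1) → FreeCommMon X) :
    monomialTensor C u = MvPolynomial.monomialOneHom C X (u 0) ⊗ₜ
      pureTensor C _ (fun i => MvPolynomial.monomialOneHom C X (Fin.tail u i)) := rfl

theorem cartierToSh_single (u : CartierSymbol X) (c : C) :
    cartierToSh X C (Finsupp.single u c) = c • monomialTensor C u.entry := by
  simp [cartierToSh]

theorem pureTensor_of_eq_zero {A : Type*} [CommRing A] [Algebra C A] {m : ℕ} (h : m = 0)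
    (x : Fin m → A) : pureTensor C A x = shPlusOne C A := by
  subst h
  exact pureTensor_fin_zero x

theorem monomialTensor_scale (a : FreeCommMon X) (v : CartierSymbol X) :
    monomialTensor C (v.scale a).entry =
      (MvPolynomial.monomialOneHom C X a * MvPolynomial.monomialOneHom C X (v.entry 0)) ⊗ₜ
        pureTensor C _ (fun i => MvPolynomial.monomialOneHom C X (Fin.tail v.entry i)) := by
  rw [monomialTensor_eq, ← map_mul]
  rfl

theorem monomialTensor_shift (u : CartierSymbol X) :
    monomialTensor C u.shift.entry = shOp C _ (monomialTensor C u.entry) := by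
  rw [monomialTensor, monomialTensor, shOp_shTensor]
  congr 1
  funext i
  refine Fin.cases ?_ (fun i => ?_) i <;> rfl

theorem cartierToSh_cartierMulSymbol (u v : CartierSymbol X) :
    cartierToSh X C (cartierMulSymbol C u v) =
      shMul _ (-1 : C) (monomialTensor C u.entry) (monomialTensor C v.entry) := by
  rw [monomialTensor_eq, monomialTensor_eq, shMul_tmul]
  unfold cartierMulSymbol
  split_ifs with hu hv
  · rw [cartierToSh_single, one_smul, monomialTensor_scale, pureTensor_of_eq_zero C hu,
      shPlusOne_mul]
  · rw [cartierToSh_single, one_smul, monomialTensor_scale, pureTensor_of_eq_zero C hv,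
      shPlusMul_comm, shPlusOne_mul, mul_comm]
  · obtain ⟨m, hm⟩ := Nat.exists_eq_succ_of_ne_zero hu
    rw [shPlusMul_eq_sum_coverSum, Finset.range_eq_Ico, Finset.sum_eq_sum_Ico_succ_bot (by omega)]
    have h0 (a b : ℕ → MvPolynomial X C) : coverSum (-1 : C) 0 u.len v.len a b = 0 := by
      rw [hm]
      exact coverSum_zero_succ _ _ _ _ _
    -- a covering pair of total size `m + n > 0` needs a position, so `k = 0` contributes nothing
    rw [h0, zero_add, TensorProduct.tmul_sum, map_sum]
    refine Finset.sum_congr (by ext; simp) fun k _ => ?_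
    rw [coverSum_neg_one, TensorProduct.tmul_sum, map_sum]
    refine Finset.sum_congr rfl fun p _ => ?_
    rw [cartierToSh_single, monomialTensor_eq, TensorProduct.tmul_smul, ← map_mul]
    rfl

variable (X)

theorem cartierToSh_isBaxterHom :
    IsBaxterHom (cartierMul X C) (cartierOp X C)
      (shMul (MvPolynomial X C) (-1 : C)) (shOp C (MvPolynomial X C)) (cartierToSh X C) where
  map_mul x y := by
    induction x using Finsupp.induction_linear with
    | zero => simp
    | add x x' hx hx' => simp [hx, hx']
    | single u c =>
      induction y using Finsupp.induction_linear with
      | zero => simp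
      | add x x' hx hx' => simp [hx, hx']
      | single v d => simp [cartierMul, cartierToSh_single, cartierToSh_cartierMulSymbol, smul_comm c d]
  map_op x := by
    induction x using Finsupp.induction_linear with
    | zero => simp
    | add x x' hx hx' => simp [hx, hx']
    | single u c => simp [cartierOp, cartierToSh_single, monomialTensor_shift]

/-! ### The basis of tensors of monomials -/

theorem DFinsupp.basis_apply_sigma {ι R : Type*} [DecidableEq ι] [Semiring R] {M : ι → Type*}
    [∀ i, AddCommMonoid (M i)] [∀ i, Module R (M i)] {η : ι → Type*}
    (b : ∀ i, Module.Basis (η i) R (M i)) (i : ι) (j : η i) :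
    DFinsupp.basis b ⟨i, j⟩ = DFinsupp.single i (b i j) := by
  classical
  apply (DFinsupp.basis b).repr.injective
  rw [Module.Basis.repr_self]
  simp only [DFinsupp.basis, LinearEquiv.trans_apply, DFinsupp.mapRange.linearEquiv_apply,
    DFinsupp.mapRange_single, Module.Basis.repr_self]
  rw [LinearEquiv.eq_symm_apply]
  simp

/-- The basis of `⨁ₖ C[X]^{⊗k}` formed by all the tensors of monomials. -/
noncomputable def shPlusMonomialBasis :
    Module.Basis (Σ k : ℕ, Fin k → (X →₀ ℕ)) C (ShPlus C (MvPolynomial X C)) :=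
  DFinsupp.basis (M := fun k : ℕ => ⨂[C]^k (MvPolynomial X C)) fun k =>
    Basis.piTensorProduct fun _ : Fin k => MvPolynomial.basisMonomials X C

theorem shPlusMonomialBasis_apply (k : ℕ) (x : Fin k → (X →₀ ℕ)) :
    shPlusMonomialBasis X C ⟨k, x⟩ =
      pureTensor C _ (fun i => MvPolynomial.monomial (x i) (1 : C)) := by
  have h := DFinsupp.basis_apply_sigma (M := fun k : ℕ => ⨂[C]^k (MvPolynomial X C))
    (fun k => Basis.piTensorProduct fun _ : Fin k => MvPolynomial.basisMonomials X C) k x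
  rw [Basis.piTensorProduct_apply, MvPolynomial.coe_basisMonomials] at h
  exact h

/-- The basis of `Ш_C(X)` formed by all the tensors of monomials. -/
noncomputable def shMonomialBasis :
    Module.Basis ((X →₀ ℕ) × Σ k : ℕ, Fin k → (X →₀ ℕ)) C (Sh C (MvPolynomial X C)) :=
  (MvPolynomial.basisMonomials X C).tensorProduct (shPlusMonomialBasis X C)

theorem shMonomialBasis_apply (a : X →₀ ℕ) (k : ℕ) (x : Fin k → (X →₀ ℕ)) :
    shMonomialBasis X C (a, ⟨k, x⟩) = MvPolynomial.monomial a 1 ⊗ₜ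
      pureTensor C _ (fun i => MvPolynomial.monomial (x i) 1) := by
  rw [shMonomialBasis, Module.Basis.tensorProduct_apply, MvPolynomial.coe_basisMonomials,
    shPlusMonomialBasis_apply]

theorem linearIndependent_monomialTensor :
    LinearIndependent C fun u : CartierSymbol X => monomialTensor C u.entry := by
  have hinj : Function.Injective fun u : CartierSymbol X =>
      (((u.entry 0).toAdd, ⟨u.len, fun i => (Fin.tail u.entry i).toAdd⟩) :
        (X →₀ ℕ) × Σ k : ℕ, Fin k → (X →₀ ℕ)) := by
    rintro ⟨m, u, hu⟩ ⟨n, v, hv⟩ h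
    simp only [Prod.mk.injEq, Sigma.mk.injEq] at h
    obtain ⟨h0, rfl, h1⟩ := h
    have huv : u = v := by
      rw [← Fin.cons_self_tail u, ← Fin.cons_self_tail v]
      exact congrArg₂ _ h0 (eq_of_heq h1)
    subst huv
    rfl
  convert (shMonomialBasis X C).linearIndependent.comp _ hinj with u
  simp only [Function.comp_apply, shMonomialBasis_apply]
  rfl

theorem cartierToSh_injective : Function.Injective (cartierToSh X C) :=
  linearIndependent_monomialTensor X C

theorem cartier_isBaxterAlgebra :
    IsBaxterAlgebra (-1 : C) (cartierMul X C) (cartierOp X C) := by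
  have hf := cartierToSh_isBaxterHom X C
  have hS := sh_isBaxterAlgebra (MvPolynomial X C) (-1 : C)
  refine ⟨fun x y z => cartierToSh_injective X C ?_, fun x y => cartierToSh_injective X C ?_,
    fun x y => cartierToSh_injective X C ?_⟩
  · simp only [hf.map_mul, hS.mul_assoc]
  · simp only [hf.map_mul, hS.mul_comm (cartierToSh X C x)]
  · simp only [map_add, map_smul, hf.map_mul, hf.map_op, hS.baxter]

/-- A symbol is a word whose last letter is not `1`. -/
def cartierSymbolEquiv : CartierSymbol X ≃
    {w : Σ m : ℕ, (Fin (m + 1) → FreeCommMon X) // w.2 (Fin.last w.1) ≠ 1} where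
  toFun u := ⟨⟨u.len, u.entry⟩, u.last_ne_one⟩
  invFun w := ⟨w.1.1, w.1.2, w.2⟩
  left_inv _ := rfl
  right_inv _ := rfl

end Comparison

theorem proposition5p1 (C : Type*) [CommRing C] (X : Type*) :
    -- both sides are Baxter algebras of weight `-1`, not necessarily with identity
    IsBaxterAlgebra (-1 : C) (cartierMul X C) (cartierOp X C) ∧
    IsBaxterAlgebra (-1 : C) (shMul (MvPolynomial X C) (-1 : C)) (shOp C (MvPolynomial X C)) ∧
    -- `f` sends `u₀ · [u₁, …, uₘ]` to `u₀ ⊗ u₁ ⊗ ⋯ ⊗ uₘ`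
    (∀ u : CartierSymbol X,
      cartierToSh X C (Finsupp.single u 1) = monomialTensor C u.entry) ∧
    -- `f` is an injective morphism of such Baxter algebras
    IsBaxterHom (cartierMul X C) (cartierOp X C)
      (shMul (MvPolynomial X C) (-1 : C)) (shOp C (MvPolynomial X C)) (cartierToSh X C) ∧
    Function.Injective (cartierToSh X C) ∧
    -- its image is a sub-Baxter algebra, with basis the tensors whose last entry is not `1`
    IsSubBaxterAlgebra (shMul (MvPolynomial X C) (-1 : C)) (shOp C (MvPolynomial X C))
      (LinearMap.range (cartierToSh X C)) ∧
    ∃ b : Module.Basis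
        {w : Σ m : ℕ, (Fin (m + 1) → FreeCommMon X) // w.2 (Fin.last w.1) ≠ 1} C
        (LinearMap.range (cartierToSh X C)),
      ∀ w, (b w : Sh C (MvPolynomial X C)) = monomialTensor C w.1.2 := by
  have hf := cartierToSh_isBaxterHom X C
  have hinj := cartierToSh_injective X C
  refine ⟨cartier_isBaxterAlgebra X C, sh_isBaxterAlgebra _ _, fun u => ?_, hf, hinj, ⟨?_, ?_⟩,
    (Finsupp.basisSingleOne.map (LinearEquiv.ofInjective _ hinj)).reindex (cartierSymbolEquiv X),
    fun w => ?_⟩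
  · rw [cartierToSh_single, one_smul]
  · rintro _ ⟨x, rfl⟩ _ ⟨y, rfl⟩
    exact ⟨_, hf.map_mul x y⟩
  · rintro _ ⟨x, rfl⟩
    exact ⟨_, hf.map_op x⟩
  · simp [cartierToSh_single, cartierSymbolEquiv]
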